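/- A hypergraph is a pair $(V,E)$, where $V$ is a finite set of vertices and $E$ is a multiset of subsets of $V$, called edges, each having at least two elements (repeated edges are allowed and count as different edges). A walk is a sequence $v_0,e_1,v_1,\dots,e_m,v_m$ with $v_i\in V$, $e_i\in E$ and $\{v_{i-1},v_i\}\subseteq e_i$ for all $i$; it is a path if all the $v_i$ are distinct and all the $e_i$ are distinct, and a cycle if $m\ge 2$, all the $e_i$ are distinct, and all the $v_i$ are distinct except that $v_0=v_m$. A hypertree is a hypergraph with no cycles in which any two vertices are joined by a path. For $n\ge 1$ and a finitely supported sequence $\lambda=(\lambda_2,\lambda_3,\dots)$ of nonnegative integers, let $\tau_{n,\lambda}$ be the number of labeled hypertrees with vertex set $[n]=\{1,\dots,n\}$ and with $\lambda_i$ edges of size $i$ for each $i\ge2$, the edges of size $i$ being labeled by $[\lambda_i]$. Define the formal power series $$T(t;u_2,u_3,\dots)=\sum_{n\ge1}\frac{t^n}{n!}\sum_{\lambda}\tau_{n,\lambda}\,\frac{u_2^{\lambda_2}u_3^{\lambda_3}\cdots}{\lambda_2!\,\lambda_3!\cdots},\qquad R=t\,\frac{\partial T}{\partial t}.$$ For each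 $n$ the inner sum is finite. Let $\tilde T(t),\tilde R(t)\in\mathbb{Q}[[t]]$ be obtained from $T$ and $R$ by setting $u_j=1$ for all $j$. Then $\tilde T$ and $\tilde R$ are the exponential generating functions of hypertrees and of rooted hypertrees by number of vertices: for $n\ge 1$ the coefficient of $t^n/n!$ in $\tilde T$ is the number of hypertrees with vertex set $[n]$ (edges unlabeled), the coefficient of $t^n/n!$ in $\tilde R$ is the number of pairs of such a hypertree and a vertex of it, and both constant terms are $0$. Moreover, $$\tilde T=(e^{\tilde R}-1)(1-\tilde R).$$ -/

import Mathlib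

/-- A hypergraph with vertex type `V` whose edges are indexed by a type `E`. Each edge has at least
two vertices; different indices are different edges, even if they have the same vertices. -/
structure IndexedHypergraph (V E : Type) where
  /-- the set of vertices of an edge -/
  verts : E → Finset V
  two_le : ∀ e, 2 ≤ (verts e).card

namespace IndexedHypergraph

/-- `v 0, e 0, v 1, …, e (m - 1), v m` is a walk with `m` edges. -/
def IsWalk {V E : Type} (H : IndexedHypergraph V E) {m : ℕ} (v : Fin (m + 1) → V)
    (e : Fin m → E) : Prop :=
  ∀ i : Fin m, v i.castSucc ∈ H.verts (e i) ∧ v i.succ ∈ H.verts (e i)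

/-- A path is a walk in which all vertices are distinct and all edges are distinct. -/
def IsPath {V E : Type} (H : IndexedHypergraph V E) {m : ℕ} (v : Fin (m + 1) → V)
    (e : Fin m → E) : Prop :=
  H.IsWalk v e ∧ Function.Injective v ∧ Function.Injective e

/-- A cycle is a walk with at least two edges in which all edges are distinct and all vertices are
distinct, except that the first and the last one agree. -/
def IsCycle {V E : Type} (H : IndexedHypergraph V E) {m : ℕ} (v : Fin (m + 1) → V)
    (e : Fin m → E) : Prop :=
  H.IsWalk v e ∧ 2 ≤ m ∧ Function.Injective e ∧
    Function.Injective (fun i : Fin m => v i.castSucc) ∧ v 0 = v (Fin.last m)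

/-- Any two vertices are the ends of a path. -/
def IsConnected {V E : Type} (H : IndexedHypergraph V E) : Prop :=
  ∀ x y : V, ∃ (m : ℕ) (v : Fin (m + 1) → V) (e : Fin m → E),
    H.IsPath v e ∧ v 0 = x ∧ v (Fin.last m) = y

/-- A hypertree is a connected hypergraph with no cycles. -/
def IsHypertree {V E : Type} (H : IndexedHypergraph V E) : Prop :=
  H.IsConnected ∧ ∀ (m : ℕ) (v : Fin (m + 1) → V) (e : Fin m → E), ¬ H.IsCycle v e

/-- A hypertree has no repeated edge. -/
theorem IsHypertree.verts_injective {V E : Type} {H : IndexedHypergraph V E}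
    (h : H.IsHypertree) : Function.Injective H.verts := by
  intro e f hef
  by_contra hne
  obtain ⟨a, ha, b, hb, hab⟩ := Finset.one_lt_card.mp (H.two_le e)
  refine h.2 2 ![a, b, a] ![e, f] ⟨?_, le_rfl, ?_, ?_, rfl⟩
  · intro i
    fin_cases i
    · exact ⟨ha, hb⟩
    · exact ⟨hef ▸ hb, hef ▸ ha⟩
  · intro i j hij
    fin_cases i <;> fin_cases j <;> simp_all
  · intro i j hij
    fin_cases i <;> fin_cases j <;> simp_all

end IndexedHypergraph

/-- A hypergraph with vertex set `V`: a multiset of subsets of `V` with at least two elements. -/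
structure MultiHypergraph (V : Type) where
  /-- the multiset of edges -/
  edges : Multiset (Finset V)
  two_le : ∀ e ∈ edges, 2 ≤ e.card

namespace MultiHypergraph

/-- The same hypergraph, with its edges indexed by the occurrences of sets in the multiset. -/
def toIndexed {V : Type} [DecidableEq V] (H : MultiHypergraph V) :
    IndexedHypergraph V H.edges.ToType where
  verts x := x.1
  two_le x := H.two_le _ (Multiset.coe_mem (x := x))

/-- A hypertree is a connected hypergraph with no cycles. -/
def IsHypertree {V : Type} [DecidableEq V] (H : MultiHypergraph V) : Prop :=
  H.toIndexed.IsHypertree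

end MultiHypergraph

/-- The number of hypertrees with vertex set `[n]` (the edges carry no labels). -/
noncomputable def numHypertrees (n : ℕ) : ℕ :=
  Nat.card {H : MultiHypergraph (Fin n) // H.IsHypertree}

/-- The number of rooted hypertrees with vertex set `[n]`, that is, of pairs of a hypertree with
vertex set `[n]` and one of its vertices. -/
noncomputable def numRootedHypertrees (n : ℕ) : ℕ :=
  Nat.card {p : MultiHypergraph (Fin n) × Fin n // p.1.IsHypertree}

/-- A labeled hypergraph with `l i` edges of size `i` for each `i`: its vertices are labeled by
`[n]` and its edges of size `i` are labeled by `[l i]`. -/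
structure LabeledHypergraph (n : ℕ) (l : ℕ →₀ ℕ) extends
    IndexedHypergraph (Fin n) (Σ i : ℕ, Fin (l i)) where
  card_verts : ∀ e, (verts e).card = e.1

/-- `τ_{n,l}`: the number of labeled hypertrees on `[n]` with `l i` edges of size `i`. -/
noncomputable def numLabeledHypertrees (n : ℕ) (l : ℕ →₀ ℕ) : ℕ :=
  Nat.card {H : LabeledHypergraph n l // H.toIndexedHypergraph.IsHypertree}

/-- `l! = ∏ i, (l i)!` -/
def edgeFactorial (l : ℕ →₀ ℕ) : ℕ := l.prod fun _ k => Nat.factorial k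

/-- For given `n`, only finitely many `l` are possible. -/
theorem finite_numLabeledHypertrees_ne_zero (n : ℕ) :
    {l : ℕ →₀ ℕ | numLabeledHypertrees n l ≠ 0}.Finite := by
  refine (Set.finite_Iic
    (Finsupp.onFinset (Finset.range (n + 1)) (fun i => if i < n + 1 then 2 ^ n else 0)
      (by intro i hi; by_contra h; simp_all))).subset ?_
  intro l hl i
  have hne : Nonempty {H : LabeledHypergraph n l // H.toIndexedHypergraph.IsHypertree} := by
    by_contra h
    rw [not_nonempty_iff] at h
    exact hl Nat.card_of_isEmpty
  obtain ⟨H, hH⟩ := hne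
  have hcard : l i ≤ 2 ^ n := by
    have hinj : Function.Injective (fun k : Fin (l i) => H.verts ⟨i, k⟩) := by
      intro a b hab
      simpa using hH.verts_injective hab
    simpa using Fintype.card_le_of_injective _ hinj
  by_cases hi : i < n + 1
  · simpa only [Finsupp.onFinset_apply, if_pos hi] using hcard
  · have : l i = 0 := by
      by_contra h0
      have h1 := H.card_verts ⟨i, ⟨0, Nat.pos_of_ne_zero h0⟩⟩
      have h2 := Finset.card_le_univ (H.verts ⟨i, ⟨0, Nat.pos_of_ne_zero h0⟩⟩)
      simp only [Fintype.card_fin] at h2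
      simp only at h1
      omega
    simp [this]

/-- `T_n = ∑ l, τ_{n,l} u^l / l!`, a polynomial in the indeterminates `u_i`. (There are no edges
with fewer than two vertices, so `u_0` and `u_1` do not occur in it.) -/
noncomputable def hypertreePoly (n : ℕ) : MvPolynomial ℕ ℚ :=
  ∑ᶠ l : ℕ →₀ ℕ, MvPolynomial.monomial l ((numLabeledHypertrees n l : ℚ) / edgeFactorial l)

theorem coeff_hypertreePoly (n : ℕ) (l : ℕ →₀ ℕ) :
    MvPolynomial.coeff l (hypertreePoly n) =
      (numLabeledHypertrees n l : ℚ) / edgeFactorial l := by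
  classical
  have hs : (Function.support fun l : ℕ →₀ ℕ => MvPolynomial.monomial l
      ((numLabeledHypertrees n l : ℚ) / edgeFactorial l)) ⊆
      ((finite_numLabeledHypertrees_ne_zero n).toFinset : Set (ℕ →₀ ℕ)) := by
    intro k hk
    simp only [Set.Finite.coe_toFinset, Set.mem_ofPred_eq]
    intro h0
    simp [h0] at hk
  rw [hypertreePoly, finsum_eq_sum_of_support_subset _ hs, MvPolynomial.coeff_sum]
  simp only [MvPolynomial.coeff_monomial, Finset.sum_ite_eq', Set.Finite.mem_toFinset,
    Set.mem_ofPred_eq]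
  by_cases h : numLabeledHypertrees n l = 0 <;> simp [h]

/-- `T(t; u_2, u_3, …) = ∑_{n ≥ 1} T_n t^n / n!`, the exponential generating function of
hypertrees, as a power series in `t` over the polynomials in the `u_i`. -/
noncomputable def hypertreeSeries : PowerSeries (MvPolynomial ℕ ℚ) :=
  PowerSeries.mk fun n =>
    if n = 0 then 0 else MvPolynomial.C (1 / (Nat.factorial n : ℚ)) * hypertreePoly n

/-- `R = t ∂T/∂t`, the exponential generating function of rooted hypertrees. -/
noncomputable def rootedHypertreeSeries : PowerSeries (MvPolynomial ℕ ℚ) :=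
  PowerSeries.X * PowerSeries.derivative (MvPolynomial ℕ ℚ) hypertreeSeries

/-- The specialization `u_j = 1` for all `j`. -/
noncomputable def specializeOne (F : PowerSeries (MvPolynomial ℕ ℚ)) : PowerSeries ℚ :=
  PowerSeries.map (MvPolynomial.eval fun _ : ℕ => (1 : ℚ)) F


/-!
In a connected hypergraph without cycles each edge `e` adds `#e - 1` vertices, so a hypertree on `n`
vertices satisfies `n - 1 = ∑ (#e - 1)`; conversely this count excludes cycles from a connected
hypergraph. Deleting an edge with `d ≥ 2` vertices leaves `d` hypertrees, each rooted at its vertex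
in that edge, and the `d` rooted hypertrees can be glued back. Hence `R ^ d / d!` is the generating
function of hypertrees with a distinguished edge of size `d`. Summing `(d - 1) R ^ d / d!` over
`d ≥ 2` counts each hypertree `n - 1` times, which gives `R - T`; the same sum is
`(R - 1) * exp R + 1`.
-/

open Finset

section EdgeClosed

variable {V : Type*} {S : Finset (Finset V)} {A U e : Finset V}

/-- A set `A` of vertices is a union of connected components of the hypergraph with edge set `S`. -/
def EdgeClosed (S : Finset (Finset V)) (A : Finset V) : Prop :=
  ∀ e ∈ S, ∀ x ∈ e, x ∈ A → e ⊆ A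

theorem EdgeClosed.compl [Fintype V] [DecidableEq V] (hA : EdgeClosed S A) : EdgeClosed S Aᶜ :=
  fun e he _ hx hxA _ hy ↦ mem_compl.mpr fun hyA ↦ mem_compl.mp hxA (hA e he _ hy hyA hx)

theorem EdgeClosed.inter_of_forall_subset [DecidableEq V] (hA : EdgeClosed S A)
    (hU : ∀ e ∈ S, e ⊆ U) : EdgeClosed S (A ∩ U) :=
  fun e he x hx hxA ↦ subset_inter (hA e he x hx (mem_inter.mp hxA).1) (hU e he)

theorem EdgeClosed.of_erase [DecidableEq V] (hA : EdgeClosed (S.erase e) A)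
    (he : ∀ x ∈ e, x ∈ A → e ⊆ A) : EdgeClosed S A := by
  intro f hf
  obtain rfl | hne := eq_or_ne f e
  · exact he
  · exact hA f (mem_erase.mpr ⟨hne, hf⟩)

theorem card_le_card_add_sum_of_edgeClosed (h : ∀ B, A ⊆ B → EdgeClosed S B → U ⊆ B) :
    #U ≤ #A + ∑ e ∈ S, (#e - 1) := by
  classical
  induction S using Finset.strongInduction generalizing A with
  | H S ih =>
    by_cases hA : EdgeClosed S A
    · exact le_add_right (card_le_card (h A subset_rfl hA))
    · simp only [EdgeClosed, not_forall] at hA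
      obtain ⟨e, he, x, hx, hxA, -⟩ := hA
      have hle : #U ≤ #(A ∪ e) + ∑ f ∈ S.erase e, (#f - 1) :=
        ih _ (erase_ssubset he) fun B hB hBS ↦
          h B (union_subset_left hB) (hBS.of_erase fun _ _ _ ↦ union_subset_right hB)
      have hinter : 0 < #(A ∩ e) := card_pos.mpr ⟨x, mem_inter.mpr ⟨hxA, hx⟩⟩
      have hunion := card_union_add_card_inter A e
      have hsum := add_sum_erase S (fun f ↦ #f - 1) he
      have he_pos : 0 < #e := card_pos.mpr ⟨x, hx⟩
      lia

/-- `S` is the set of edges of a hypertree with vertex set `U`. Given connectedness, the absence of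
cycles is expressed by the number of vertices: each edge `e` adds `#e - 1` new ones. -/
structure IsHypertreeOn (U : Finset V) (S : Finset (Finset V)) : Prop where
  two_le : ∀ e ∈ S, 2 ≤ #e
  subset : ∀ e ∈ S, e ⊆ U
  conn : ∀ A ⊆ U, A.Nonempty → EdgeClosed S A → A = U
  count : ∑ e ∈ S, (#e - 1) + 1 = #U

theorem IsHypertreeOn.nonempty_of_mem (hS : IsHypertreeOn U S) (he : e ∈ S) : e.Nonempty :=
  card_pos.mp (two_pos.trans_le (hS.two_le e he))

open Classical in
/-- The hypertrees with vertex set `U`, as sets of edges. -/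
noncomputable def hypertreesOn [Fintype V] (U : Finset V) : Finset (Finset (Finset V)) :=
  {S | IsHypertreeOn U S}

theorem mem_hypertreesOn [Fintype V] : S ∈ hypertreesOn U ↔ IsHypertreeOn U S := by
  simp [hypertreesOn]

end EdgeClosed

namespace IndexedHypergraph

variable {V E : Type} {H : IndexedHypergraph V E} {F G : Finset E} {A : Finset V} {x y : V} {e₀ : E}

/-- Two vertices are adjacent if they lie in a common edge whose index is in `F`. -/
def sectionGraph (H : IndexedHypergraph V E) (F : Finset E) : SimpleGraph V where
  Adj x y := x ≠ y ∧ ∃ e ∈ F, x ∈ H.verts e ∧ y ∈ H.verts e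
  symm := ⟨fun _ _ ⟨h, e, he, hx, hy⟩ ↦ ⟨h.symm, e, he, hy, hx⟩⟩
  loopless := ⟨fun _ h ↦ h.1 rfl⟩

theorem sectionGraph_mono (h : F ⊆ G) : H.sectionGraph F ≤ H.sectionGraph G :=
  fun _ _ ⟨hne, e, he, hxy⟩ ↦ ⟨hne, e, h he, hxy⟩

theorem exists_walk_length_le_one (he : e₀ ∈ F) (hx : x ∈ H.verts e₀) (hy : y ∈ H.verts e₀) :
    ∃ p : (H.sectionGraph F).Walk x y, p.length ≤ 1 := by
  obtain rfl | hxy := eq_or_ne x y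
  · exact ⟨.nil, zero_le_one⟩
  · exact ⟨SimpleGraph.Adj.toWalk ⟨hxy, e₀, he, hx, hy⟩, le_rfl⟩

theorem sectionGraph_reachable_of_mem (he : e₀ ∈ F) (hx : x ∈ H.verts e₀) (hy : y ∈ H.verts e₀) :
    (H.sectionGraph F).Reachable x y :=
  (exists_walk_length_le_one he hx hy).nonempty

-- A shortest walk is a path: a repeated edge would allow a shortcut.
theorem exists_isPath_of_reachable (h : (H.sectionGraph F).Reachable x y) :
    ∃ (m : ℕ) (v : Fin (m + 1) → V) (e : Fin m → E),
      H.IsPath v e ∧ v 0 = x ∧ v (Fin.last m) = y ∧ ∀ i, e i ∈ F := by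
  obtain ⟨p, hp⟩ := h.exists_walk_length_eq_dist
  have hadj (i : Fin p.length) : ∃ e ∈ F, p.getVert i ∈ H.verts e ∧
      p.getVert (i + 1) ∈ H.verts e := (p.adj_getVert_succ i.2).2
  choose e heF hsrc htgt using hadj
  have hne {i j : Fin p.length} (hij : i < j) : e i ≠ e j := by
    intro heq
    obtain ⟨q, hq⟩ := exists_walk_length_le_one (heF i) (hsrc i) (heq ▸ htgt j)
    have hshort := SimpleGraph.dist_le (((p.take i).append q).append (p.drop (j + 1)))
    simp only [SimpleGraph.Walk.length_append, SimpleGraph.Walk.take_length,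
      SimpleGraph.Walk.drop_length] at hshort
    lia
  refine ⟨p.length, fun i ↦ p.getVert i, e, ⟨fun i ↦ ⟨hsrc i, htgt i⟩, fun i j hij ↦ ?_,
    .of_lt_imp_ne fun i j ↦ hne⟩, by simp, by simp, heF⟩
  exact Fin.ext ((p.isPath_of_length_eq_dist hp).getVert_injOn (Nat.le_of_lt_succ i.2)
    (Nat.le_of_lt_succ j.2) hij)

theorem exists_isCycle_of_reachable (hxy : x ≠ y) (h : (H.sectionGraph F).Reachable x y)
    (he₀ : e₀ ∉ F) (hx : x ∈ H.verts e₀) (hy : y ∈ H.verts e₀) :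
    ∃ (m : ℕ) (v : Fin (m + 1) → V) (e : Fin m → E), H.IsCycle v e := by
  obtain ⟨m, v, e, ⟨hw, hv, he⟩, h0, hm, hF⟩ := exists_isPath_of_reachable h
  have hm0 : m ≠ 0 := by
    rintro rfl
    exact hxy (h0.symm.trans hm)
  refine ⟨m + 1, Fin.snoc v x, Fin.snoc e e₀, fun i ↦ ?_, by lia, ?_, by simpa using hv, ?_⟩
  · refine Fin.lastCases (by simp [hm, hx, hy]) (fun i ↦ ?_) i
    rw [Fin.succ_castSucc]
    simpa only [Fin.snoc_castSucc] using hw i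
  · refine Fin.snoc_injective_iff.mpr ⟨he, ?_⟩
    rintro ⟨i, rfl⟩
    exact he₀ (hF i)
  · rw [Fin.snoc_last, ← Fin.castSucc_zero, Fin.snoc_castSucc, h0]

section Connected

variable [Fintype E] [DecidableEq V]

theorem edgeClosed_image_verts :
    EdgeClosed (univ.image H.verts) A ↔ ∀ e, ∀ x ∈ H.verts e, x ∈ A → H.verts e ⊆ A := by
  simp [EdgeClosed]

theorem isConnected_iff [Fintype V] :
    H.IsConnected ↔
      ∀ A : Finset V, A.Nonempty → EdgeClosed (univ.image H.verts) A → A = univ := by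
  classical
  simp only [edgeClosed_image_verts]
  constructor
  · rintro hH A ⟨x, hx⟩ hA
    refine eq_univ_of_forall fun y ↦ ?_
    obtain ⟨m, v, e, ⟨hw, -, -⟩, h0, hm⟩ := hH x y
    have hv (i : Fin (m + 1)) : v i ∈ A := by
      induction i using Fin.induction with
      | zero => exact h0 ▸ hx
      | succ i ih => exact hA (e i) _ (hw i).1 ih (hw i).2
    exact hm ▸ hv _
  · intro h x y
    have hreach := h {z | (H.sectionGraph univ).Reachable x z} ⟨x, by simp⟩ fun e z hz hxz w hw ↦ by
      rw [mem_filter_univ] at hxz ⊢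
      exact hxz.trans (sectionGraph_reachable_of_mem (mem_univ e) hz hw)
    obtain ⟨m, v, e, hp, h0, hm, -⟩ := exists_isPath_of_reachable
      ((mem_filter_univ y).mp (hreach.ge (mem_univ y)))
    exact ⟨m, v, e, hp, h0, hm⟩

end Connected

section Count

/-- The edges with index in `F` form a hypertree with vertex set `A`: they connect it, and the
absence of cycles among them is expressed by the number of vertices. -/
structure IsSubtree (H : IndexedHypergraph V E) (F : Finset E) (A : Finset V) : Prop where
  nonempty : A.Nonempty
  reachable : ∀ x ∈ A, ∀ y ∈ A, (H.sectionGraph F).Reachable x y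
  subset : ∀ e ∈ F, H.verts e ⊆ A
  count : ∑ e ∈ F, (#(H.verts e) - 1) + 1 = #A

theorem isSubtree_singleton (x : V) : H.IsSubtree ∅ {x} where
  nonempty := singleton_nonempty x
  reachable := by simp
  subset := by simp
  count := by simp

theorem IsSubtree.card_inter_le_one [DecidableEq V] (hA : H.IsSubtree F A) (hH : H.IsHypertree)
    (he : e₀ ∉ F) : #(H.verts e₀ ∩ A) ≤ 1 := by
  by_contra! hlt
  obtain ⟨x, hx, y, hy, hxy⟩ := one_lt_card.mp hlt
  rw [mem_inter] at hx hy
  obtain ⟨m, v, e, hc⟩ :=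
    exists_isCycle_of_reachable hxy (hA.reachable x hx.2 y hy.2) he hx.1 hy.1
  exact hH.2 m v e hc

theorem IsSubtree.insert_edge [DecidableEq V] [DecidableEq E] (hA : H.IsSubtree F A)
    (hH : H.IsHypertree) (he : e₀ ∉ F) (hx : x ∈ H.verts e₀) (hxA : x ∈ A) :
    H.IsSubtree (insert e₀ F) (A ∪ H.verts e₀) where
  nonempty := hA.nonempty.mono subset_union_left
  reachable := by
    have hreach (y) (hy : y ∈ A ∪ H.verts e₀) :
        (H.sectionGraph (insert e₀ F)).Reachable x y := by
      rcases mem_union.mp hy with hy | hy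
      · exact (hA.reachable x hxA y hy).mono (sectionGraph_mono (subset_insert e₀ F))
      · exact sectionGraph_reachable_of_mem (mem_insert_self e₀ F) hx hy
    exact fun y hy z hz ↦ (hreach y hy).symm.trans (hreach z hz)
  subset := by
    intro e he
    rcases mem_insert.mp he with rfl | he
    · exact subset_union_right
    · exact (hA.subset e he).trans subset_union_left
  count := by
    have hle := hA.card_inter_le_one hH he
    have hpos : 0 < #(H.verts e₀ ∩ A) := card_pos.mpr ⟨x, mem_inter.mpr ⟨hx, hxA⟩⟩
    have hunion := card_union_add_card_inter (H.verts e₀) A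
    have htwo := H.two_le e₀
    have hcount := hA.count
    rw [sum_insert he, union_comm]
    lia

-- A maximal subtree contains all vertices, since it could be extended by an edge meeting it.
theorem IsHypertree.sum_card_sub_one_add_one [Fintype V] [Nonempty V] [Fintype E]
    (hH : H.IsHypertree) : ∑ e, (#(H.verts e) - 1) + 1 = Fintype.card V := by
  classical
  obtain ⟨x⟩ := ‹Nonempty V›
  obtain ⟨F, ⟨A, hA⟩, hmax⟩ := (Set.toFinite {F | ∃ A, H.IsSubtree F A}).exists_maximal
    ⟨∅, {x}, isSubtree_singleton x⟩
  have hA_univ : A = univ := by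
    refine isConnected_iff.mp hH.1 A hA.nonempty (edgeClosed_image_verts.mpr fun e y hy hyA ↦ ?_)
    refine hA.subset e ?_
    by_contra he
    exact he (hmax ⟨_, hA.insert_edge hH he hy hyA⟩ (subset_insert e F) (mem_insert_self e F))
  have hF_univ : F = univ := by
    refine eq_univ_of_forall fun e ↦ ?_
    by_contra he
    have hle := hA.card_inter_le_one hH he
    rw [hA_univ, inter_univ] at hle
    exact absurd (H.two_le e) (by lia)
  rw [← card_univ, ← hA_univ, ← hA.count, hF_univ]

theorem IsCycle.card_biUnion_le [DecidableEq V] {m : ℕ} {v : Fin (m + 1) → V} {e : Fin m → E}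
    (h : H.IsCycle v e) :
    #(univ.biUnion fun i ↦ H.verts (e i)) ≤ ∑ i, (#(H.verts (e i)) - 1) := by
  obtain ⟨hw, hm, -, hv, h0⟩ := h
  have hprev (i : Fin m) : ∃ j ≠ i, v j.succ = v i.castSucc := by
    obtain hi | hi := Nat.eq_zero_or_pos (i : ℕ)
    · refine ⟨⟨m - 1, by lia⟩, Fin.ne_of_val_ne (by grind), ?_⟩
      have hlast : (⟨m - 1, by lia⟩ : Fin m).succ = Fin.last m := Fin.ext (by grind)
      have hzero : i.castSucc = 0 := Fin.ext hi
      rw [hlast, hzero, h0]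
    · exact ⟨⟨i - 1, by lia⟩, Fin.ne_of_val_ne (by grind), congrArg v (Fin.ext (by grind))⟩
  have hcover : (univ.biUnion fun i ↦ H.verts (e i)) ⊆
      univ.biUnion fun i ↦ (H.verts (e i)).erase (v i.castSucc) := by
    intro x hx
    obtain ⟨i, -, hx⟩ := mem_biUnion.mp hx
    obtain rfl | hxi := eq_or_ne x (v i.castSucc)
    · obtain ⟨j, hne, hj⟩ := hprev i
      exact mem_biUnion.mpr ⟨j, mem_univ j, mem_erase.mpr ⟨hv.ne hne.symm, hj ▸ (hw j).2⟩⟩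
    · exact mem_biUnion.mpr ⟨i, mem_univ i, mem_erase.mpr ⟨hxi, hx⟩⟩
  calc #(univ.biUnion fun i ↦ H.verts (e i))
      ≤ #(univ.biUnion fun i ↦ (H.verts (e i)).erase (v i.castSucc)) := card_le_card hcover
    _ ≤ ∑ i, #((H.verts (e i)).erase (v i.castSucc)) := Finset.card_biUnion_le
    _ = ∑ i, (#(H.verts (e i)) - 1) := sum_congr rfl fun i _ ↦ card_erase_of_mem (hw i).1

variable [Fintype V] [Fintype E] [DecidableEq V]

theorem not_isCycle_of_isHypertreeOn (hinj : Function.Injective H.verts)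
    (hS : IsHypertreeOn univ (univ.image H.verts)) {m : ℕ} {v : Fin (m + 1) → V}
    {e : Fin m → E} : ¬ H.IsCycle v e := by
  classical
  intro hcyc
  set A := univ.biUnion fun i ↦ H.verts (e i)
  have hA_card : #A ≤ ∑ i, (#(H.verts (e i)) - 1) := hcyc.card_biUnion_le
  have hA_nonempty : A.Nonempty :=
    ⟨_, mem_biUnion.mpr ⟨⟨0, two_pos.trans_le hcyc.2.1⟩, mem_univ _, (hcyc.1 _).1⟩⟩
  have hcover : #(univ : Finset V) ≤ #A + ∑ s ∈ (univ.image e)ᶜ.image H.verts, (#s - 1) := by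
    refine card_le_card_add_sum_of_edgeClosed fun B hAB hB ↦
      (hS.conn B (subset_univ B) (hA_nonempty.mono hAB) ?_).ge
    refine edgeClosed_image_verts.mpr fun f x hx hxB ↦ ?_
    by_cases hf : f ∈ univ.image e
    · obtain ⟨i, -, rfl⟩ := mem_image.mp hf
      exact (subset_biUnion_of_mem (fun i ↦ H.verts (e i)) (mem_univ i)).trans hAB
    · exact hB _ (mem_image_of_mem _ (mem_compl.mpr hf)) x hx hxB
  have hcount := hS.count
  rw [sum_image hinj.injOn] at hcover hcount
  have hsplit := sum_add_sum_compl (univ.image e) fun f ↦ #(H.verts f) - 1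
  rw [sum_image hcyc.2.2.1.injOn] at hsplit
  lia

theorem isHypertree_iff [Nonempty V] :
    H.IsHypertree ↔
      Function.Injective H.verts ∧ IsHypertreeOn univ (univ.image H.verts) := by
  constructor
  · refine fun h ↦ ⟨h.verts_injective, ?_, fun e _ ↦ subset_univ e,
      fun A _ ↦ isConnected_iff.mp h.1 A, ?_⟩
    · simpa using H.two_le
    · rw [sum_image h.verts_injective.injOn, card_univ, h.sum_card_sub_one_add_one]
  · exact fun ⟨hinj, hS⟩ ↦ ⟨isConnected_iff.mpr fun A ↦ hS.conn A (subset_univ A),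
      fun _ _ _ ↦ not_isCycle_of_isHypertreeOn hinj hS⟩

end Count

end IndexedHypergraph

namespace MultiHypergraph

variable {V : Type} [DecidableEq V] {H : MultiHypergraph V}

theorem image_verts_toIndexed : univ.image H.toIndexed.verts = H.edges.toFinset := by
  ext s
  rw [mem_image, Multiset.mem_toFinset]
  constructor
  · rintro ⟨x, -, rfl⟩
    exact Multiset.coe_mem
  · exact fun hs ↦ ⟨⟨s, ⟨0, Multiset.count_pos.mpr hs⟩⟩, mem_univ _, rfl⟩

theorem injective_verts_toIndexed_iff : Function.Injective H.toIndexed.verts ↔ H.edges.Nodup := by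
  rw [Multiset.nodup_iff_count_le_one]
  constructor
  · intro h s
    by_contra! hlt
    have heq := @h ⟨s, ⟨0, by lia⟩⟩ ⟨s, ⟨1, hlt⟩⟩ rfl
    exact absurd (congrArg (fun x ↦ (x.2 : ℕ)) heq) zero_ne_one
  · rintro h ⟨s, i⟩ ⟨t, j⟩ (rfl : s = t)
    obtain rfl : i = j := Fin.ext (by have := h s; lia)
    rfl

theorem isHypertree_iff [Fintype V] [Nonempty V] :
    H.IsHypertree ↔ H.edges.Nodup ∧ IsHypertreeOn univ H.edges.toFinset := by
  rw [MultiHypergraph.IsHypertree, IndexedHypergraph.isHypertree_iff, image_verts_toIndexed,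
    injective_verts_toIndexed_iff]

end MultiHypergraph

section Count

variable {n : ℕ}

theorem numHypertrees_eq_card_hypertreesOn (hn : n ≠ 0) :
    numHypertrees n = #(hypertreesOn (univ : Finset (Fin n))) := by
  have : NeZero n := ⟨hn⟩
  rw [numHypertrees, ← Nat.card_eq_finsetCard]
  exact Nat.card_congr
    { toFun := fun H ↦ ⟨H.1.edges.toFinset,
        mem_hypertreesOn.mpr (MultiHypergraph.isHypertree_iff.mp H.2).2⟩
      invFun := fun S ↦ ⟨⟨S.1.val, (mem_hypertreesOn.mp S.2).two_le⟩,
        MultiHypergraph.isHypertree_iff.mpr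
          ⟨S.1.nodup, S.1.val_toFinset.symm ▸ mem_hypertreesOn.mp S.2⟩⟩
      left_inv := fun ⟨⟨E, _⟩, hH⟩ ↦ Subtype.ext <| by
        simpa using (MultiHypergraph.isHypertree_iff.mp hH).1.dedup
      right_inv := fun S ↦ Subtype.ext S.1.val_toFinset }

theorem numRootedHypertrees_eq (n : ℕ) : numRootedHypertrees n = n * numHypertrees n := by
  rw [numRootedHypertrees, numHypertrees, mul_comm,
    Nat.card_congr Equiv.prodSubtypeFstEquivSubtypeProd, Nat.card_prod, Nat.card_fin]

theorem numRootedHypertrees_eq_mul_card (n : ℕ) :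
    numRootedHypertrees n = n * #(hypertreesOn (univ : Finset (Fin n))) := by
  obtain rfl | hn := eq_or_ne n 0
  · rw [numRootedHypertrees_eq, zero_mul, zero_mul]
  · rw [numRootedHypertrees_eq, numHypertrees_eq_card_hypertreesOn hn]

end Count

section EdgeLabeling

/-- The numbers of edges of each size. -/
noncomputable def edgeProfile {V : Type*} (S : Finset (Finset V)) : ℕ →₀ ℕ :=
  ∑ e ∈ S, Finsupp.single #e 1

variable {V : Type*} {S : Finset (Finset V)} {l : ℕ →₀ ℕ}

theorem card_edge_card_eq (S : Finset (Finset V)) (i : ℕ) :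
    Nat.card {e : S // #e.1 = i} = edgeProfile S i := by
  rw [Nat.card_congr (Equiv.subtypeSubtypeEquivSubtypeInter (· ∈ S) (#· = i)),
    Nat.subtype_card {e ∈ S | #e = i} (fun _ ↦ mem_filter), edgeProfile, Finsupp.finsetSum_apply,
    card_filter]
  simp only [Finsupp.single_apply]

instance finite_sigma_fin_finsupp (l : ℕ →₀ ℕ) : Finite (Σ i, Fin (l i)) := by
  refine .of_injective (β := Σ i : l.support, Fin (l i))
    (fun x ↦ ⟨⟨x.1, Finsupp.mem_support_iff.mpr x.2.pos.ne'⟩, x.2⟩) ?_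
  rintro ⟨i, x⟩ ⟨j, y⟩ h
  simp only [Sigma.mk.injEq, Subtype.mk.injEq] at h ⊢
  exact h

/-- The labelings of the edges of `S` such that the edges of size `i` are labeled by `[l i]`. -/
def EdgeLabeling (l : ℕ →₀ ℕ) (S : Finset (Finset V)) : Type _ :=
  {φ : (Σ i, Fin (l i)) ≃ S // ∀ x, #(φ x).1 = x.1}

theorem EdgeLabeling.edgeProfile_eq (φ : EdgeLabeling l S) : edgeProfile S = l := by
  ext i
  have hφ : {x : Σ i, Fin (l i) // x.1 = i} ≃ {e : S // #e.1 = i} :=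
    φ.1.subtypeEquiv fun x ↦ by rw [φ.2]
  rw [← card_edge_card_eq, ← Nat.card_congr hφ, Nat.card_congr (Equiv.sigmaSubtype i), Nat.card_fin]

theorem EdgeLabeling.image_eq [DecidableEq V] [Fintype (Σ i, Fin (l i))] (φ : EdgeLabeling l S) :
    (univ.image fun x ↦ (φ.1 x).1) = S := by
  ext s
  simp only [mem_image, mem_univ, true_and]
  constructor
  · rintro ⟨x, rfl⟩
    exact (φ.1 x).2
  · exact fun hs ↦ ⟨φ.1.symm ⟨s, hs⟩, by rw [Equiv.apply_symm_apply]⟩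

theorem nonempty_edgeLabeling (S : Finset (Finset V)) : Nonempty (EdgeLabeling (edgeProfile S) S) :=
  let φ (i : ℕ) : Fin (edgeProfile S i) ≃ {e : S // #e.1 = i} :=
    (Finite.equivFinOfCardEq (card_edge_card_eq S i)).symm
  ⟨(Equiv.sigmaCongrRight φ).trans (Equiv.sigmaFiberEquiv _), fun x ↦ (φ x.1 x.2).2⟩

theorem card_perm_comp_fst (l : ℕ →₀ ℕ) :
    Nat.card {g : Equiv.Perm (Σ i, Fin (l i)) // Sigma.fst ∘ g = Sigma.fst} = edgeFactorial l := by
  classical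
  have := Fintype.ofFinite (Σ i, Fin (l i))
  rw [Nat.card_eq_fintype_card, DomMulAct.stabilizer_card', edgeFactorial, Finsupp.prod]
  refine prod_congr ?_ fun i _ ↦ by
    rw [Fintype.card_congr (Equiv.sigmaSubtype (β := fun i ↦ Fin (l i)) i), Fintype.card_fin]
  ext i
  rw [mem_image, Finsupp.mem_support_iff]
  constructor
  · rintro ⟨x, -, rfl⟩
    exact x.2.pos.ne'
  · exact fun hi ↦ ⟨⟨i, ⟨0, Nat.pos_of_ne_zero hi⟩⟩, mem_univ _, rfl⟩

theorem card_edgeLabeling (l : ℕ →₀ ℕ) (S : Finset (Finset V)) :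
    Nat.card (EdgeLabeling l S) = if edgeProfile S = l then edgeFactorial l else 0 := by
  split_ifs with h
  · subst h
    obtain ⟨φ⟩ := nonempty_edgeLabeling S
    have hφ (e : S) : (φ.1.symm e).1 = #e.1 := by rw [← φ.2, Equiv.apply_symm_apply]
    rw [← card_perm_comp_fst]
    refine Nat.card_congr (Equiv.subtypeEquiv (Equiv.equivCongr (.refl _) φ.1.symm) fun ψ ↦ ?_)
    simp [funext_iff, hφ]
  · have : IsEmpty (EdgeLabeling l S) := ⟨fun φ ↦ h φ.edgeProfile_eq⟩
    exact Nat.card_of_isEmpty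

end EdgeLabeling

section Specialization

variable {n : ℕ}

theorem numLabeledHypertrees_eq_card_sigma (hn : n ≠ 0) (l : ℕ →₀ ℕ) :
    numLabeledHypertrees n l =
      Nat.card (Σ S : hypertreesOn (univ : Finset (Fin n)), EdgeLabeling l S.1) := by
  have : NeZero n := ⟨hn⟩
  have := Fintype.ofFinite (Σ i, Fin (l i))
  symm
  refine Nat.card_congr (.ofBijective (fun p ↦ ⟨⟨⟨fun x ↦ (p.2.1 x).1, fun x ↦ ?_⟩, p.2.2⟩,
    IndexedHypergraph.isHypertree_iff.mpr ⟨?_, ?_⟩⟩) ⟨?_, ?_⟩)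
  · exact (mem_hypertreesOn.mp p.1.2).two_le _ (p.2.1 x).2
  · exact Subtype.val_injective.comp p.2.1.injective
  · exact p.2.image_eq.symm ▸ mem_hypertreesOn.mp p.1.2
  · rintro ⟨⟨S, hS⟩, φ⟩ ⟨⟨S', hS'⟩, φ'⟩ h
    simp only [Subtype.mk.injEq, LabeledHypergraph.mk.injEq, IndexedHypergraph.mk.injEq] at h
    obtain rfl : S = S' := φ.image_eq.symm.trans (h ▸ φ'.image_eq)
    obtain rfl : φ = φ' := Subtype.ext (Equiv.ext fun x ↦ Subtype.ext (congrFun h x))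
    rfl
  · rintro ⟨H, hH⟩
    obtain ⟨hinj, hS⟩ := IndexedHypergraph.isHypertree_iff.mp hH
    have hbij : Function.Bijective fun x ↦
        (⟨H.verts x, mem_image_of_mem _ (mem_univ x)⟩ : univ.image H.verts) :=
      ⟨fun x y hxy ↦ hinj (congrArg Subtype.val hxy), fun ⟨s, hs⟩ ↦
        (mem_image.mp hs).imp fun x hx ↦ Subtype.ext hx.2⟩
    exact ⟨⟨⟨_, mem_hypertreesOn.mpr hS⟩, ⟨.ofBijective _ hbij, H.card_verts⟩⟩, rfl⟩

theorem numLabeledHypertrees_eq (hn : n ≠ 0) (l : ℕ →₀ ℕ) :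
    numLabeledHypertrees n l =
      edgeFactorial l * #{S ∈ hypertreesOn (univ : Finset (Fin n)) | edgeProfile S = l} := by
  have (S : hypertreesOn (univ : Finset (Fin n))) : Finite (EdgeLabeling l S.1) := Subtype.finite
  rw [numLabeledHypertrees_eq_card_sigma hn, Nat.card_sigma]
  simp only [card_edgeLabeling]
  rw [sum_coe_sort (hypertreesOn univ) fun S ↦ if edgeProfile S = l then edgeFactorial l else 0,
    ← sum_filter, sum_const, smul_eq_mul, mul_comm]

theorem hypertreePoly_eq (hn : n ≠ 0) :
    hypertreePoly n =
      ∑ S ∈ hypertreesOn (univ : Finset (Fin n)), MvPolynomial.monomial (edgeProfile S) 1 := by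
  classical
  ext l
  have hl : (edgeFactorial l : ℚ) ≠ 0 :=
    Nat.cast_ne_zero.mpr (prod_ne_zero_iff.mpr fun _ _ ↦ Nat.factorial_ne_zero _)
  rw [coeff_hypertreePoly, numLabeledHypertrees_eq hn, MvPolynomial.coeff_sum, Nat.cast_mul,
    mul_div_cancel_left₀ _ hl]
  simp only [MvPolynomial.coeff_monomial, sum_boole]

theorem specializeOne_hypertreeSeries :
    specializeOne hypertreeSeries = PowerSeries.mk fun n ↦
      if n = 0 then 0 else (numHypertrees n : ℚ) / (Nat.factorial n : ℚ) := by
  ext n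
  rw [specializeOne, PowerSeries.coeff_map, hypertreeSeries, PowerSeries.coeff_mk,
    PowerSeries.coeff_mk]
  split_ifs with hn
  · exact map_zero _
  · rw [hypertreePoly_eq hn, numHypertrees_eq_card_hypertreesOn hn]
    simp [MvPolynomial.eval_monomial, Finsupp.prod, div_eq_inv_mul]

theorem specializeOne_X_mul_derivative (F : PowerSeries (MvPolynomial ℕ ℚ)) :
    specializeOne (PowerSeries.X * PowerSeries.derivative _ F) =
      PowerSeries.X * PowerSeries.derivative ℚ (specializeOne F) := by
  rw [specializeOne, map_mul, PowerSeries.map_X]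
  congr 1
  ext n
  simp [specializeOne, PowerSeries.coeff_derivative]

theorem specializeOne_rootedHypertreeSeries :
    specializeOne rootedHypertreeSeries = PowerSeries.mk fun n ↦
      (numRootedHypertrees n : ℚ) / (Nat.factorial n : ℚ) := by
  rw [rootedHypertreeSeries, specializeOne_X_mul_derivative, specializeOne_hypertreeSeries]
  ext n
  cases n with
  | zero => simp [numRootedHypertrees_eq]
  | succ n =>
    rw [PowerSeries.coeff_succ_X_mul, PowerSeries.coeff_derivative, PowerSeries.coeff_mk,
      PowerSeries.coeff_mk, numRootedHypertrees_eq, if_neg n.succ_ne_zero]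
    push_cast
    ring

end Specialization

section Component

variable {V : Type*} [Fintype V] {S : Finset (Finset V)} {A e : Finset V} {x y z : V}

open Classical in
/-- The vertices of the connected component of `x` in the hypergraph with edge set `S`. -/
noncomputable def edgeComponent (S : Finset (Finset V)) (x : V) : Finset V :=
  {y | ∀ A, EdgeClosed S A → x ∈ A → y ∈ A}

theorem mem_edgeComponent : y ∈ edgeComponent S x ↔ ∀ A, EdgeClosed S A → x ∈ A → y ∈ A := by
  simp [edgeComponent]

theorem self_mem_edgeComponent (S : Finset (Finset V)) (x : V) : x ∈ edgeComponent S x :=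
  mem_edgeComponent.mpr fun _ _ h ↦ h

theorem edgeClosed_edgeComponent (S : Finset (Finset V)) (x : V) :
    EdgeClosed S (edgeComponent S x) := fun e he _ hy hyx _ hz ↦
  mem_edgeComponent.mpr fun A hA hx ↦ hA e he _ hy (mem_edgeComponent.mp hyx A hA hx) hz

theorem EdgeClosed.edgeComponent_subset (hA : EdgeClosed S A) (hx : x ∈ A) :
    edgeComponent S x ⊆ A :=
  fun _ hy ↦ mem_edgeComponent.mp hy A hA hx

theorem EdgeClosed.mem_iff_of_mem_edgeComponent (hA : EdgeClosed S A)
    (hy : y ∈ edgeComponent S x) : y ∈ A ↔ x ∈ A := by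
  classical
  refine ⟨fun hyA ↦ ?_, fun hx ↦ hA.edgeComponent_subset hx hy⟩
  by_contra hxA
  exact mem_compl.mp (hA.compl.edgeComponent_subset (mem_compl.mpr hxA) hy) hyA

namespace IsHypertreeOn

variable [DecidableEq V]

theorem exists_mem_edgeComponent_erase (hS : IsHypertreeOn univ S) (he : e ∈ S) (z : V) :
    ∃ x ∈ e, z ∈ edgeComponent (S.erase e) x := by
  set A := e.biUnion (edgeComponent (S.erase e))
  have he_subset : e ⊆ A := fun x hx ↦ mem_biUnion.mpr ⟨x, hx, self_mem_edgeComponent _ x⟩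
  have hA_closed : EdgeClosed (S.erase e) A := by
    intro f hf y hy hyA
    obtain ⟨x, hx, hyx⟩ := mem_biUnion.mp hyA
    exact (edgeClosed_edgeComponent _ x f hf y hy hyx).trans (subset_biUnion_of_mem _ hx)
  have hA_univ : A = univ := hS.conn A (subset_univ A) ((hS.nonempty_of_mem he).mono he_subset)
    (hA_closed.of_erase fun _ _ _ ↦ he_subset)
  exact mem_biUnion.mp (hA_univ.ge (mem_univ z))

theorem eq_of_mem_edgeComponent_erase (hS : IsHypertreeOn univ S) (he : e ∈ S) (hx : x ∈ e)
    (hy : y ∈ e) (hzx : z ∈ edgeComponent (S.erase e) x)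
    (hzy : z ∈ edgeComponent (S.erase e) y) : x = y := by
  by_contra hxy
  have hcover : #(univ : Finset V) ≤ #(e.erase x) + ∑ f ∈ S.erase e, (#f - 1) := by
    refine card_le_card_add_sum_of_edgeClosed fun B hB hB_closed ↦ ?_
    have hyB : y ∈ B := hB (mem_erase.mpr ⟨Ne.symm hxy, hy⟩)
    have hxB : x ∈ B := (hB_closed.mem_iff_of_mem_edgeComponent hzx).mp
      ((hB_closed.mem_iff_of_mem_edgeComponent hzy).mpr hyB)
    have heB : e ⊆ B := (erase_subset_iff_of_mem hxB).mp hB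
    exact (hS.conn B (subset_univ B) ⟨y, hyB⟩ (hB_closed.of_erase fun _ _ _ ↦ heB)).ge
  have hsum := add_sum_erase S (fun f ↦ #f - 1) he
  have hcard := card_erase_of_mem hx
  have hcount := hS.count
  lia

end IsHypertreeOn

end Component

section Glue

variable {V ι : Type*}

section

variable [DecidableEq V] [Fintype ι]

/-- The edges of the hypergraph obtained from hypergraphs with edge sets `T i`, on disjoint sets of
vertices, by joining them with an additional edge containing the vertex `a i` of each. -/
def glue (a : ι ↪ V) (T : ι → Finset (Finset V)) : Finset (Finset V) :=
  insert (univ.map a) (univ.biUnion T)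

variable {a : ι ↪ V} {T : ι → Finset (Finset V)}

theorem map_mem_glue : univ.map a ∈ glue a T :=
  mem_insert_self _ _

theorem mem_glue_of_mem {i : ι} {e : Finset V} (he : e ∈ T i) : e ∈ glue a T :=
  mem_insert_of_mem (mem_biUnion.mpr ⟨i, mem_univ i, he⟩)

end

variable [Fintype V] [DecidableEq ι] {f : V → ι}

/-- The fiber of `f` over `i`, as a `Finset`. -/
def fiberFinset (f : V → ι) (i : ι) : Finset V :=
  {x | f x = i}

theorem mem_fiberFinset {i : ι} {x : V} : x ∈ fiberFinset f i ↔ f x = i :=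
  mem_filter_univ x

variable [Fintype ι]

theorem sum_card_fiberFinset (f : V → ι) : ∑ i, #(fiberFinset f i) = Fintype.card V :=
  (card_eq_sum_card_fiberwise fun x _ ↦ mem_univ (f x)).symm

variable [DecidableEq V] {a : ι ↪ V} {T : ι → Finset (Finset V)} {S : Finset (Finset V)}

theorem map_notMem_biUnion [Nontrivial ι] (hfa : Function.LeftInverse f a)
    (hT : ∀ i, ∀ e ∈ T i, e ⊆ fiberFinset f i) : univ.map a ∉ univ.biUnion T := by
  intro h
  obtain ⟨i, -, hi⟩ := mem_biUnion.mp h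
  obtain ⟨j, hj⟩ := exists_ne i
  exact hj ((hfa j).symm.trans (mem_fiberFinset.mp (hT i _ hi (mem_map_of_mem a (mem_univ j)))))

theorem glue_erase_map [Nontrivial ι] (hfa : Function.LeftInverse f a)
    (hT : ∀ i, ∀ e ∈ T i, e ⊆ fiberFinset f i) :
    (glue a T).erase (univ.map a) = univ.biUnion T :=
  erase_insert (map_notMem_biUnion hfa hT)

theorem filter_subset_fiberFinset_biUnion (hT : ∀ i, ∀ e ∈ T i, e ⊆ fiberFinset f i)
    (hne : ∀ i, ∀ e ∈ T i, e.Nonempty) (i : ι) :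
    {e ∈ univ.biUnion T | e ⊆ fiberFinset f i} = T i := by
  ext e
  refine ⟨fun h ↦ ?_, fun h ↦ mem_filter.mpr ⟨mem_biUnion.mpr ⟨i, mem_univ i, h⟩, hT i e h⟩⟩
  obtain ⟨he, hi⟩ := mem_filter.mp h
  obtain ⟨j, -, hj⟩ := mem_biUnion.mp he
  obtain ⟨x, hx⟩ := hne j e hj
  obtain rfl : f x = i := mem_fiberFinset.mp (hi hx)
  obtain rfl : f x = j := mem_fiberFinset.mp (hT j e hj hx)
  exact hj

theorem sum_glue [Nontrivial ι] (hfa : Function.LeftInverse f a)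
    (hT : ∀ i, ∀ e ∈ T i, e ⊆ fiberFinset f i) (hne : ∀ i, ∀ e ∈ T i, e.Nonempty) :
    ∑ e ∈ glue a T, (#e - 1) = (Fintype.card ι - 1) + ∑ i, ∑ e ∈ T i, (#e - 1) := by
  rw [glue, sum_insert (map_notMem_biUnion hfa hT), card_map, card_univ, sum_biUnion]
  intro i _ j _ hij
  refine disjoint_left.mpr fun e hi hj ↦ hij ?_
  obtain ⟨x, hx⟩ := hne i e hi
  exact (mem_fiberFinset.mp (hT i e hi hx)).symm.trans (mem_fiberFinset.mp (hT j e hj hx))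

theorem edgeComponent_biUnion (hT : ∀ i, IsHypertreeOn (fiberFinset f i) (T i)) (x : V) :
    edgeComponent (univ.biUnion T) x = fiberFinset f (f x) := by
  have hclosed : EdgeClosed (univ.biUnion T) (fiberFinset f (f x)) := by
    intro e he y hy hyx
    obtain ⟨i, -, hi⟩ := mem_biUnion.mp he
    obtain rfl : f y = i := mem_fiberFinset.mp ((hT i).subset e hi hy)
    exact mem_fiberFinset.mp hyx ▸ (hT _).subset e hi
  exact (hT (f x)).conn _ (hclosed.edgeComponent_subset (mem_fiberFinset.mpr rfl))
    ⟨x, self_mem_edgeComponent _ x⟩ fun e he ↦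
      edgeClosed_edgeComponent _ x e (mem_biUnion.mpr ⟨_, mem_univ _, he⟩)

theorem isHypertreeOn_glue [Nontrivial ι] (hfa : Function.LeftInverse f a)
    (hT : ∀ i, IsHypertreeOn (fiberFinset f i) (T i)) : IsHypertreeOn univ (glue a T) where
  two_le e he := by
    rcases mem_insert.mp he with rfl | he
    · rw [card_map, card_univ]
      exact Fintype.one_lt_card
    · obtain ⟨i, -, hi⟩ := mem_biUnion.mp he
      exact (hT i).two_le e hi
  subset e _ := subset_univ e
  conn := by
    rintro A - ⟨x, hx⟩ hA
    have hfiber {y : V} (hy : y ∈ A) {z : V} (hzy : f z = f y) : z ∈ A := by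
      have hA_biUnion : EdgeClosed (univ.biUnion T) A := fun e he ↦ hA e (mem_insert_of_mem he)
      refine hA_biUnion.edgeComponent_subset hy ?_
      rw [edgeComponent_biUnion hT]
      exact mem_fiberFinset.mpr hzy
    have hmap : univ.map a ⊆ A :=
      hA _ map_mem_glue _ (mem_map_of_mem a (mem_univ (f x))) (hfiber hx (hfa _))
    exact eq_univ_of_forall fun y ↦
      hfiber (hmap (mem_map_of_mem a (mem_univ (f y)))) (hfa _).symm
  count := by
    have hsum : ∑ i, (∑ e ∈ T i, (#e - 1) + 1) = Fintype.card V :=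
      (sum_congr rfl fun i _ ↦ (hT i).count).trans (sum_card_fiberFinset f)
    rw [sum_add_distrib, sum_const, card_univ, smul_eq_mul, mul_one] at hsum
    have hpos : 0 < Fintype.card ι := Fintype.card_pos
    rw [sum_glue hfa (fun i ↦ (hT i).subset) fun i _ ↦ (hT i).nonempty_of_mem, card_univ]
    lia

theorem apply_mem_of_isHypertreeOn_glue (hfa : Function.LeftInverse f a)
    (hT : ∀ i, ∀ e ∈ T i, e ⊆ fiberFinset f i) (hS : IsHypertreeOn univ (glue a T)) {i : ι}
    {A : Finset V} (hAi : A ⊆ fiberFinset f i) (hA : A.Nonempty) (hA_closed : EdgeClosed (T i) A) :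
    a i ∈ A := by
  by_contra hai
  have hA_glue : EdgeClosed (glue a T) A := by
    intro e he x hx hxA
    obtain rfl : f x = i := mem_fiberFinset.mp (hAi hxA)
    rcases mem_insert.mp he with rfl | he
    · obtain ⟨j, -, rfl⟩ := mem_map.mp hx
      exact absurd ((hfa j).symm ▸ hxA) hai
    · obtain ⟨j, -, hj⟩ := mem_biUnion.mp he
      obtain rfl : f x = j := mem_fiberFinset.mp (hT j e hj hx)
      exact hA_closed e hj x hx hxA
  exact hai ((hS.conn A (subset_univ A) hA hA_glue).ge (mem_univ _))

theorem eq_fiberFinset_of_isHypertreeOn_glue (hfa : Function.LeftInverse f a)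
    (hT : ∀ i, ∀ e ∈ T i, e ⊆ fiberFinset f i) (hS : IsHypertreeOn univ (glue a T)) {i : ι}
    {A : Finset V} (hAi : A ⊆ fiberFinset f i) (hA : A.Nonempty) (hA_closed : EdgeClosed (T i) A) :
    A = fiberFinset f i := by
  have haA : a i ∈ A := apply_mem_of_isHypertreeOn_glue hfa hT hS hAi hA hA_closed
  refine hAi.antisymm fun x hxi ↦ ?_
  by_contra hxA
  have haAc : a i ∈ Aᶜ ∩ fiberFinset f i := apply_mem_of_isHypertreeOn_glue hfa hT hS
    inter_subset_right ⟨x, mem_inter.mpr ⟨mem_compl.mpr hxA, hxi⟩⟩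
    (hA_closed.compl.inter_of_forall_subset (hT i))
  exact mem_compl.mp (mem_inter.mp haAc).1 haA

theorem isHypertreeOn_fiberFinset_of_glue [Nontrivial ι] (hfa : Function.LeftInverse f a)
    (hT : ∀ i, ∀ e ∈ T i, e ⊆ fiberFinset f i) (hS : IsHypertreeOn univ (glue a T)) (i : ι) :
    IsHypertreeOn (fiberFinset f i) (T i) where
  two_le e he := hS.two_le e (mem_glue_of_mem he)
  subset := hT i
  conn _ := eq_fiberFinset_of_isHypertreeOn_glue hfa hT hS
  count := by
    have hle (j : ι) : #(fiberFinset f j) ≤ ∑ e ∈ T j, (#e - 1) + 1 := by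
      rw [add_comm, ← card_singleton (a j)]
      refine card_le_card_add_sum_of_edgeClosed fun B hB hB_closed ↦ ?_
      have hfiber : B ∩ fiberFinset f j = fiberFinset f j :=
        eq_fiberFinset_of_isHypertreeOn_glue hfa hT hS inter_subset_right
          ⟨a j, mem_inter.mpr ⟨singleton_subset_iff.mp hB, mem_fiberFinset.mpr (hfa j)⟩⟩
          (hB_closed.inter_of_forall_subset (hT j))
      exact inter_eq_right.mp hfiber
    have hsum : ∑ j, #(fiberFinset f j) = ∑ j, (∑ e ∈ T j, (#e - 1) + 1) := by
      have hcount := hS.count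
      rw [sum_glue hfa hT fun i e he ↦ hS.nonempty_of_mem (mem_glue_of_mem he), card_univ]
        at hcount
      have hpos : 0 < Fintype.card ι := Fintype.card_pos
      rw [sum_card_fiberFinset, sum_add_distrib, sum_const, card_univ, smul_eq_mul, mul_one]
      lia
    exact ((sum_eq_sum_iff_of_le fun j _ ↦ hle j).mp hsum i (mem_univ i)).symm

theorem glue_injective [Nontrivial ι] {g : V → ι} {T' : ι → Finset (Finset V)}
    (hfa : Function.LeftInverse f a) (hT : ∀ i, IsHypertreeOn (fiberFinset f i) (T i))
    (hga : Function.LeftInverse g a) (hT' : ∀ i, IsHypertreeOn (fiberFinset g i) (T' i))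
    (h : glue a T = glue a T') : f = g ∧ T = T' := by
  have hbiUnion : univ.biUnion T = univ.biUnion T' := by
    rw [← glue_erase_map hfa fun i ↦ (hT i).subset, h, glue_erase_map hga fun i ↦ (hT' i).subset]
  obtain rfl : f = g := by
    funext x
    have hcomp := edgeComponent_biUnion hT (a (f x))
    rw [hbiUnion, edgeComponent_biUnion hT', hfa, hga] at hcomp
    exact (mem_fiberFinset.mp (hcomp.ge (mem_fiberFinset.mpr rfl))).symm
  refine ⟨rfl, funext fun i ↦ ?_⟩
  rw [← filter_subset_fiberFinset_biUnion (fun i ↦ (hT i).subset)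
    (fun i _ ↦ (hT i).nonempty_of_mem) i, hbiUnion, filter_subset_fiberFinset_biUnion
    (fun i ↦ (hT' i).subset) fun i _ ↦ (hT' i).nonempty_of_mem]

theorem IsHypertreeOn.exists_leftInverse_edgeClosed (hS : IsHypertreeOn univ S)
    (ha : univ.map a ∈ S) :
    ∃ f : V → ι, Function.LeftInverse f a ∧
      ∀ i, EdgeClosed (S.erase (univ.map a)) (fiberFinset f i) := by
  have hcover (x : V) : ∃ i, x ∈ edgeComponent (S.erase (univ.map a)) (a i) := by
    simpa using hS.exists_mem_edgeComponent_erase ha x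
  choose f hf using hcover
  have hunique {x : V} {i : ι} (hx : x ∈ edgeComponent (S.erase (univ.map a)) (a i)) : f x = i :=
    a.injective <| hS.eq_of_mem_edgeComponent_erase ha (mem_map_of_mem a (mem_univ _))
      (mem_map_of_mem a (mem_univ _)) (hf x) hx
  refine ⟨f, fun i ↦ hunique (self_mem_edgeComponent _ _), fun i e he x hx hxi y hy ↦ ?_⟩
  obtain rfl := mem_fiberFinset.mp hxi
  exact mem_fiberFinset.mpr (hunique (edgeClosed_edgeComponent _ _ e he x hx (hf x) hy))

theorem IsHypertreeOn.exists_glue [Nontrivial ι] (hS : IsHypertreeOn univ S)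
    (ha : univ.map a ∈ S) :
    ∃ f : V → ι, Function.LeftInverse f a ∧ ∃ T : ι → Finset (Finset V),
      (∀ i, IsHypertreeOn (fiberFinset f i) (T i)) ∧ glue a T = S := by
  obtain ⟨f, hfa, hclosed⟩ := hS.exists_leftInverse_edgeClosed ha
  set T : ι → Finset (Finset V) := fun i ↦ {e ∈ S.erase (univ.map a) | e ⊆ fiberFinset f i}
  have hbiUnion : univ.biUnion T = S.erase (univ.map a) := by
    ext e
    refine ⟨fun h ↦ ?_, fun he ↦ ?_⟩
    · obtain ⟨i, -, he⟩ := mem_biUnion.mp h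
      exact (mem_filter.mp he).1
    · obtain ⟨x, hx⟩ := hS.nonempty_of_mem (mem_of_mem_erase he)
      exact mem_biUnion.mpr ⟨f x, mem_univ _,
        mem_filter.mpr ⟨he, hclosed (f x) e he x hx (mem_fiberFinset.mpr rfl)⟩⟩
  have hglue : glue a T = S := by rw [glue, hbiUnion, insert_erase ha]
  exact ⟨f, hfa, T, isHypertreeOn_fiberFinset_of_glue hfa (fun i e he ↦ (mem_filter.mp he).2)
    (hglue.symm ▸ hS), hglue⟩

theorem card_filter_mem_hypertreesOn [Nontrivial ι] (a : ι ↪ V) :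
    #{S ∈ hypertreesOn (univ : Finset V) | univ.map a ∈ S} =
      ∑ f : V → ι with Function.LeftInverse f a, ∏ i, #(hypertreesOn (fiberFinset f i)) := by
  simp only [← Fintype.card_piFinset]
  rw [← card_sigma]
  symm
  refine card_bij (fun p _ ↦ glue a p.2) ?_ ?_ ?_
  · rintro ⟨f, T⟩ hp
    simp only [mem_sigma, mem_filter_univ, Fintype.mem_piFinset, mem_hypertreesOn] at hp
    rw [mem_filter, mem_hypertreesOn]
    exact ⟨isHypertreeOn_glue hp.1 hp.2, map_mem_glue⟩
  · rintro ⟨f, T⟩ hp ⟨g, T'⟩ hq h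
    simp only [mem_sigma, mem_filter_univ, Fintype.mem_piFinset, mem_hypertreesOn] at hp hq
    obtain ⟨rfl, rfl⟩ := glue_injective hp.1 hp.2 hq.1 hq.2 h
    rfl
  · intro S hS
    rw [mem_filter, mem_hypertreesOn] at hS
    obtain ⟨f, hf, T, hT, rfl⟩ := hS.1.exists_glue hS.2
    refine ⟨⟨f, T⟩, ?_, rfl⟩
    simp only [mem_sigma, mem_filter_univ, Fintype.mem_piFinset, mem_hypertreesOn]
    exact ⟨hf, hT⟩

end Glue

section Map

variable {V W : Type*} {T : Finset (Finset W)} {A U : Finset W}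

theorem edgeClosed_map (φ : W ↪ V) :
    EdgeClosed (T.map (mapEmbedding φ).toEmbedding) (A.map φ) ↔ EdgeClosed T A := by
  simp only [EdgeClosed, forall_mem_map, RelEmbedding.coe_toEmbedding, mapEmbedding_apply,
    mem_map', map_subset_map]

theorem isHypertreeOn_map (φ : W ↪ V) :
    IsHypertreeOn (U.map φ) (T.map (mapEmbedding φ).toEmbedding) ↔ IsHypertreeOn U T := by
  refine ⟨fun h ↦ ⟨?_, ?_, fun A hAU hA hA_closed ↦ ?_, ?_⟩,
    fun h ↦ ⟨?_, ?_, fun B hBU hB hB_closed ↦ ?_, ?_⟩⟩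
  · simpa using h.two_le
  · simpa using h.subset
  · exact map_injective φ (h.conn (A.map φ) (map_subset_map.mpr hAU) (hA.map)
      ((edgeClosed_map φ).mpr hA_closed))
  · simpa using h.count
  · simpa using h.two_le
  · simpa using h.subset
  · obtain ⟨A, hAU, rfl⟩ := subset_map_iff.mp hBU
    rw [h.conn A hAU (map_nonempty.mp hB) ((edgeClosed_map φ).mp hB_closed)]
  · simpa using h.count

theorem card_hypertreesOn_map [Fintype V] [Fintype W] (φ : W ↪ V) (U : Finset W) :
    #(hypertreesOn (U.map φ)) = #(hypertreesOn U) := by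
  classical
  refine (card_bij (fun T _ ↦ T.map (mapEmbedding φ).toEmbedding)
    (fun T hT ↦ ?_) (fun _ _ _ _ h ↦ map_injective _ h) fun S hS ↦ ?_).symm
  · exact mem_hypertreesOn.mpr ((isHypertreeOn_map φ).mpr (mem_hypertreesOn.mp hT))
  · have hS_map : S ⊆ univ.map (mapEmbedding φ).toEmbedding := fun e he ↦ by
      obtain ⟨s, -, rfl⟩ := subset_map_iff.mp ((mem_hypertreesOn.mp hS).subset e he)
      exact mem_map_of_mem (mapEmbedding φ).toEmbedding (mem_univ s)
    obtain ⟨T, -, rfl⟩ := subset_map_iff.mp hS_map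
    exact ⟨T, mem_hypertreesOn.mpr ((isHypertreeOn_map φ).mp (mem_hypertreesOn.mp hS)), rfl⟩

theorem card_hypertreesOn_eq_card_hypertreesOn_fin [Fintype V] (U : Finset V) :
    #(hypertreesOn U) = #(hypertreesOn (univ : Finset (Fin #U))) := by
  have hU : univ.map (U.equivFin.symm.toEmbedding.trans (.subtype (· ∈ U))) = U := by
    rw [← map_map, map_univ_equiv, univ_eq_attach, attach_map_val]
  conv_lhs => rw [← hU]
  exact card_hypertreesOn_map _ _

theorem numRootedHypertrees_card [Fintype V] (U : Finset V) :
    numRootedHypertrees #U = #U * #(hypertreesOn U) := by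
  rw [numRootedHypertrees_eq_mul_card, ← card_hypertreesOn_eq_card_hypertreesOn_fin]

end Map

section Counting

variable {V ι : Type*} [Fintype V] [Fintype ι]

section

variable [DecidableEq V]

theorem card_filter_embedding_map_eq (e : Finset V) :
    #{a : ι ↪ V | univ.map a = e} =
      if #e = Fintype.card ι then (Fintype.card ι).factorial else 0 := by
  split_ifs with h
  · have hmem_iff (a : ι ↪ V) : univ.map a = e ↔ ∀ i, a i ∈ e := by
      refine ⟨fun ha i ↦ ha ▸ mem_map_of_mem a (mem_univ i), fun ha ↦ ?_⟩
      refine eq_of_subset_of_card_le (fun x hx ↦ ?_) (by rw [card_map, h, card_univ])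
      obtain ⟨i, -, rfl⟩ := mem_map.mp hx
      exact ha i
    have equiv : {a : ι ↪ V // univ.map a = e} ≃ (ι ↪ e) :=
      (Equiv.subtypeEquivRight hmem_iff).trans (Equiv.codRestrict ι (e : Set V))
    rw [← Fintype.card_subtype, Fintype.card_congr equiv, Fintype.card_embedding_eq,
      Fintype.card_coe, h, Nat.descFactorial_self]
  · rw [card_eq_zero, filter_eq_empty_iff]
    rintro a - rfl
    exact h (by rw [card_map, card_univ])

theorem card_filter_embedding_map_mem (S : Finset (Finset V)) :
    #{a : ι ↪ V | univ.map a ∈ S} =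
      (Fintype.card ι).factorial * #{e ∈ S | #e = Fintype.card ι} := by
  have hmaps : Set.MapsTo (fun a : ι ↪ V ↦ univ.map a)
      ({a : ι ↪ V | univ.map a ∈ S} : Finset (ι ↪ V)) S := fun a ha ↦ (mem_filter.mp ha).2
  rw [card_eq_sum_card_fiberwise hmaps, card_filter, mul_sum]
  refine sum_congr rfl fun e he ↦ ?_
  rw [mul_ite, mul_one, mul_zero, ← card_filter_embedding_map_eq, filter_filter]
  congr 1
  ext a
  simp only [mem_filter_univ, and_iff_right_iff_imp]
  rintro rfl
  exact he

end

variable [DecidableEq ι]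

theorem prod_card_fiberFinset (f : V → ι) :
    ∏ i, #(fiberFinset f i) = #{a : ι ↪ V | Function.LeftInverse f a} := by
  rw [← Fintype.card_piFinset]
  refine (card_bij (fun (a : ι ↪ V) _ ↦ (a : ι → V)) (fun a ha ↦ ?_)
    (fun _ _ _ _ h ↦ DFunLike.coe_injective h) fun x hx ↦ ?_).symm
  · exact Fintype.mem_piFinset.mpr fun i ↦ mem_fiberFinset.mpr ((mem_filter.mp ha).2 i)
  · have hx : Function.LeftInverse f x := fun i ↦
      mem_fiberFinset.mp (Fintype.mem_piFinset.mp hx i)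
    exact ⟨⟨x, hx.injective⟩, mem_filter.mpr ⟨mem_univ _, hx⟩, rfl⟩

theorem sum_prod_numRootedHypertrees [DecidableEq V] [Nontrivial ι] :
    ∑ f : V → ι, ∏ i, numRootedHypertrees #(fiberFinset f i) =
      (Fintype.card ι).factorial *
        ∑ S ∈ hypertreesOn (univ : Finset V), #{e ∈ S | #e = Fintype.card ι} := by
  calc ∑ f : V → ι, ∏ i, numRootedHypertrees #(fiberFinset f i)
    _ = ∑ f : V → ι, ∑ _a ∈ {a : ι ↪ V | Function.LeftInverse f a},
          ∏ i, #(hypertreesOn (fiberFinset f i)) := by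
      refine sum_congr rfl fun f _ ↦ ?_
      simp_rw [numRootedHypertrees_card]
      rw [prod_mul_distrib, prod_card_fiberFinset, sum_const, smul_eq_mul]
    _ = ∑ a : ι ↪ V, ∑ f : V → ι with Function.LeftInverse f a,
          ∏ i, #(hypertreesOn (fiberFinset f i)) := by
      simp_rw [sum_filter]
      exact sum_comm
    _ = ∑ a : ι ↪ V, #{S ∈ hypertreesOn (univ : Finset V) | univ.map a ∈ S} :=
      sum_congr rfl fun a _ ↦ (card_filter_mem_hypertreesOn a).symm
    _ = ∑ S ∈ hypertreesOn (univ : Finset V), #{a : ι ↪ V | univ.map a ∈ S} := by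
      simp_rw [card_filter]
      exact sum_comm
    _ = _ := by simp_rw [card_filter_embedding_map_mem, mul_sum]

end Counting

section ExponentialGeneratingFunction

variable {V ι : Type*} [Fintype V] [DecidableEq ι]

open MvPolynomial in
theorem prod_X_eq_monomial_card_fiberFinset [Finite ι] (R : Type*) [CommSemiring R] (f : V → ι) :
    ∏ v, (X (f v) : MvPolynomial ι R) =
      monomial (Finsupp.equivFunOnFinite.symm fun i ↦ #(fiberFinset f i)) 1 := by
  have hsum : ∑ v, Finsupp.single (f v) 1 =
      Finsupp.equivFunOnFinite.symm fun i ↦ #(fiberFinset f i) := by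
    ext i
    simp [Finsupp.finsetSum_apply, Finsupp.single_apply, fiberFinset]
  simp only [X, ← monomial_sum_one, hsum]

variable [Fintype ι] [DecidableEq V]

open MvPolynomial in
theorem card_filter_card_fiberFinset_eq (l : ι →₀ ℕ) (hl : ∑ i, l i = Fintype.card V) :
    #{f : V → ι | ∀ i, #(fiberFinset f i) = l i} = Nat.multinomial univ l := by
  have hexpand : (∑ i, X i : MvPolynomial ι ℕ) ^ Fintype.card V = ∑ f : V → ι, ∏ v, X (f v) := by
    rw [← card_univ, ← prod_const, prod_univ_sum, Fintype.piFinset_univ]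
  have hcoeff := congrArg (coeff l) hexpand
  rw [coeff_sum_X_pow_of_fintype, if_pos (by rwa [Finsupp.sum_fintype _ _ fun _ ↦ rfl]),
    Nat.cast_id, ← Finsupp.multinomial_of_support_subset (subset_univ _), coeff_sum] at hcoeff
  rw [hcoeff, card_filter]
  refine sum_congr rfl fun f _ ↦ ?_
  rw [prod_X_eq_monomial_card_fiberFinset, coeff_monomial]
  simp only [Finsupp.ext_iff, Finsupp.coe_equivFunOnFinite_symm]

open PowerSeries in
theorem factorial_mul_coeff_prod_mk_div_factorial {K : Type*} [Field K] [CharZero K]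
    (b : ι → ℕ → K) :
    (Fintype.card V).factorial * coeff (Fintype.card V) (∏ i, mk fun m ↦ b i m / m.factorial) =
      ∑ f : V → ι, ∏ i, b i #(fiberFinset f i) := by
  have hmaps (f : V → ι) : Finsupp.equivFunOnFinite.symm (fun i ↦ #(fiberFinset f i)) ∈
      finsuppAntidiag univ (Fintype.card V) :=
    mem_finsuppAntidiag.mpr ⟨sum_card_fiberFinset f, subset_univ _⟩
  rw [coeff_prod, mul_sum, ← sum_fiberwise_of_maps_to fun f _ ↦ hmaps f]
  refine sum_congr rfl fun l hl ↦ ?_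
  have hl_sum : ∑ i, l i = Fintype.card V := (mem_finsuppAntidiag.mp hl).1
  have hfact : (∏ i, ((l i).factorial : K)) * Nat.multinomial univ l =
      (Fintype.card V).factorial := by
    exact_mod_cast hl_sum ▸ Nat.multinomial_spec univ l
  have hfact_ne : ∏ i, ((l i).factorial : K) ≠ 0 :=
    prod_ne_zero_iff.mpr fun i _ ↦ Nat.cast_ne_zero.mpr (l i).factorial_ne_zero
  calc (Fintype.card V).factorial * ∏ i, coeff (l i) (mk fun m ↦ b i m / m.factorial)
    _ = Nat.multinomial univ l * ∏ i, b i (l i) := by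
      simp only [coeff_mk, prod_div_distrib, ← hfact]
      field_simp
    _ = ∑ f : V → ι with ∀ i, #(fiberFinset f i) = l i, ∏ i, b i (l i) := by
      rw [sum_const, card_filter_card_fiberFinset_eq l hl_sum, nsmul_eq_mul]
    _ = ∑ f : V → ι with Finsupp.equivFunOnFinite.symm (fun i ↦ #(fiberFinset f i)) = l,
          ∏ i, b i #(fiberFinset f i) := by
      simp only [Finsupp.ext_iff, Finsupp.coe_equivFunOnFinite_symm]
      exact sum_congr rfl fun f hf ↦ prod_congr rfl fun i _ ↦ by rw [(mem_filter.mp hf).2 i]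

end ExponentialGeneratingFunction

section FunctionalEquation

open PowerSeries

theorem coeff_subst_eq_sum_range {K : Type*} [CommRing K] {a : PowerSeries K}
    (ha : constantCoeff a = 0) (f : PowerSeries K) (n : ℕ) :
    coeff n (f.subst a) = ∑ d ∈ range (n + 1), coeff d f * coeff n (a ^ d) := by
  rw [coeff_subst' (.of_constantCoeff_zero' ha),
    finsum_eq_sum_of_support_subset (s := range (n + 1))]
  · simp only [smul_eq_mul]
  · refine Function.support_subset_iff'.mpr fun d hd ↦ ?_
    have hnd : n < d := by simpa using hd
    rw [X_pow_dvd_iff.mp (pow_dvd_pow_of_dvd (X_dvd_iff.mpr ha) d) n hnd, smul_zero]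

theorem coeff_X_sub_one_mul_exp (d : ℕ) :
    coeff d ((X - 1) * exp ℚ : PowerSeries ℚ) = (d - 1) / d.factorial := by
  cases d with
  | zero => simp [sub_mul]
  | succ d =>
    have hd : (d.factorial : ℚ) ≠ 0 := Nat.cast_ne_zero.mpr d.factorial_ne_zero
    simp only [sub_mul, one_mul, map_sub, coeff_succ_X_mul, coeff_exp, Nat.factorial_succ,
      eq_ratCast, Rat.cast_id]
    push_cast
    field_simp

theorem constantCoeff_specializeOne_rootedHypertreeSeries :
    constantCoeff (specializeOne rootedHypertreeSeries) = 0 := by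
  rw [specializeOne_rootedHypertreeSeries, ← coeff_zero_eq_constantCoeff_apply, coeff_mk,
    numRootedHypertrees_eq, zero_mul, Nat.cast_zero, zero_div]

theorem factorial_mul_coeff_specializeOne_hypertreeSeries {n : ℕ} (hn : n ≠ 0) :
    n.factorial * coeff n (specializeOne hypertreeSeries) =
      #(hypertreesOn (univ : Finset (Fin n))) := by
  rw [specializeOne_hypertreeSeries, coeff_mk, if_neg hn, numHypertrees_eq_card_hypertreesOn hn,
    mul_div_cancel₀ _ (Nat.cast_ne_zero.mpr n.factorial_ne_zero)]

theorem factorial_mul_coeff_specializeOne_rootedHypertreeSeries (n : ℕ) :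
    n.factorial * coeff n (specializeOne rootedHypertreeSeries) =
      n * #(hypertreesOn (univ : Finset (Fin n))) := by
  rw [specializeOne_rootedHypertreeSeries, coeff_mk, numRootedHypertrees_eq_mul_card,
    mul_div_cancel₀ _ (Nat.cast_ne_zero.mpr n.factorial_ne_zero), Nat.cast_mul]

theorem factorial_mul_coeff_specializeOne_rootedHypertreeSeries_pow (n : ℕ) {d : ℕ} (hd : 2 ≤ d) :
    n.factorial * coeff n (specializeOne rootedHypertreeSeries ^ d) =
      d.factorial * ∑ S ∈ hypertreesOn (univ : Finset (Fin n)), (#{e ∈ S | #e = d} : ℚ) := by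
  have : Nontrivial (Fin d) := Fin.nontrivial_iff_two_le.mpr hd
  have hcount := sum_prod_numRootedHypertrees (V := Fin n) (ι := Fin d)
  have hprod := factorial_mul_coeff_prod_mk_div_factorial (V := Fin n)
    fun (_ : Fin d) m ↦ (numRootedHypertrees m : ℚ)
  rw [prod_const, card_univ] at hprod
  simp only [Fintype.card_fin] at hcount hprod
  rw [specializeOne_rootedHypertreeSeries, hprod]
  exact_mod_cast hcount

theorem IsHypertreeOn.sum_sub_one_mul_card_filter {V : Type*} [Fintype V]
    {S : Finset (Finset V)} (hS : IsHypertreeOn univ S) :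
    ∑ d ∈ range (Fintype.card V + 1), (d - 1 : ℚ) * #{e ∈ S | #e = d} = Fintype.card V - 1 := by
  have hmaps : ∀ e ∈ S, #e ∈ range (Fintype.card V + 1) := fun e _ ↦
    mem_range_succ_iff.mpr (card_le_univ e)
  calc ∑ d ∈ range (Fintype.card V + 1), (d - 1 : ℚ) * #{e ∈ S | #e = d}
    _ = ∑ d ∈ range (Fintype.card V + 1), ∑ e ∈ S with #e = d, (#e - 1 : ℚ) := by
      refine sum_congr rfl fun d _ ↦ ?_
      rw [sum_congr rfl fun e he ↦ by rw [(mem_filter.mp he).2], sum_const, nsmul_eq_mul, mul_comm]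
    _ = ∑ e ∈ S, (#e - 1 : ℚ) := sum_fiberwise_of_maps_to hmaps _
    _ = ((∑ e ∈ S, (#e - 1) : ℕ) : ℚ) := by
      rw [Nat.cast_sum]
      exact sum_congr rfl fun e he ↦ (Nat.cast_pred (two_pos.trans_le (hS.two_le e he))).symm
    _ = Fintype.card V - 1 := by
      rw [← card_univ, ← hS.count, Nat.cast_add, Nat.cast_one, add_sub_cancel_right]

theorem factorial_mul_coeff_X_sub_one_mul_exp_mul_coeff_pow {n : ℕ} (hn : n ≠ 0) (d : ℕ) :
    n.factorial * (coeff d ((X - 1) * exp ℚ : PowerSeries ℚ) *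
        coeff n (specializeOne rootedHypertreeSeries ^ d)) =
      ∑ S ∈ hypertreesOn (univ : Finset (Fin n)), (d - 1 : ℚ) * #{e ∈ S | #e = d} := by
  rw [coeff_X_sub_one_mul_exp, mul_left_comm, ← mul_sum]
  obtain rfl | rfl | hd : d = 0 ∨ d = 1 ∨ 2 ≤ d := by lia
  · have hempty : ∀ S ∈ hypertreesOn (univ : Finset (Fin n)), (#{e ∈ S | #e = 0} : ℚ) = 0 := by
      intro S hS
      rw [Nat.cast_eq_zero, card_eq_zero, filter_eq_empty_iff]
      exact fun e he ↦ ((mem_hypertreesOn.mp hS).nonempty_of_mem he).card_ne_zero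
    rw [sum_eq_zero hempty, pow_zero, coeff_one, if_neg hn, mul_zero, mul_zero, mul_zero]
  · simp
  · rw [factorial_mul_coeff_specializeOne_rootedHypertreeSeries_pow n hd, ← mul_assoc,
      div_mul_cancel₀ _ (Nat.cast_ne_zero.mpr d.factorial_ne_zero)]

theorem subst_specializeOne_rootedHypertreeSeries :
    ((X - 1) * exp ℚ).subst (specializeOne rootedHypertreeSeries) =
      specializeOne rootedHypertreeSeries - 1 - specializeOne hypertreeSeries := by
  ext n
  rw [coeff_subst_eq_sum_range constantCoeff_specializeOne_rootedHypertreeSeries]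
  obtain rfl | hn := eq_or_ne n 0
  · simp [constantCoeff_specializeOne_rootedHypertreeSeries, specializeOne_hypertreeSeries]
  refine mul_left_cancel₀ (Nat.cast_ne_zero.mpr n.factorial_ne_zero)
    (?_ : (n.factorial : ℚ) * _ = _)
  calc n.factorial * ∑ d ∈ range (n + 1), coeff d ((X - 1) * exp ℚ : PowerSeries ℚ) *
        coeff n (specializeOne rootedHypertreeSeries ^ d)
    _ = ∑ S ∈ hypertreesOn (univ : Finset (Fin n)), ∑ d ∈ range (n + 1),
          (d - 1 : ℚ) * #{e ∈ S | #e = d} := by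
      rw [mul_sum, sum_comm]
      exact sum_congr rfl fun d _ ↦ factorial_mul_coeff_X_sub_one_mul_exp_mul_coeff_pow hn d
    _ = ∑ S ∈ hypertreesOn (univ : Finset (Fin n)), (n - 1 : ℚ) :=
      sum_congr rfl fun S hS ↦ by
        simpa only [Fintype.card_fin] using (mem_hypertreesOn.mp hS).sum_sub_one_mul_card_filter
    _ = n * #(hypertreesOn (univ : Finset (Fin n))) - #(hypertreesOn (univ : Finset (Fin n))) := by
      rw [sum_const, nsmul_eq_mul]
      ring
    _ = n.factorial * coeff n
          (specializeOne rootedHypertreeSeries - 1 - specializeOne hypertreeSeries) := by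
      rw [map_sub, map_sub, coeff_one, if_neg hn, sub_zero, mul_sub,
        factorial_mul_coeff_specializeOne_hypertreeSeries hn,
        factorial_mul_coeff_specializeOne_rootedHypertreeSeries]

end FunctionalEquation

theorem mainTheorem6 :
    (specializeOne hypertreeSeries = PowerSeries.mk fun n : ℕ =>
      if n = 0 then 0 else (numHypertrees n : ℚ) / (Nat.factorial n : ℚ)) ∧
    (specializeOne rootedHypertreeSeries = PowerSeries.mk fun n : ℕ =>
      (numRootedHypertrees n : ℚ) / (Nat.factorial n : ℚ)) ∧
    specializeOne hypertreeSeries =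
      ((PowerSeries.exp ℚ).subst (specializeOne rootedHypertreeSeries) - 1) *
        (1 - specializeOne rootedHypertreeSeries) := by
  refine ⟨specializeOne_hypertreeSeries, specializeOne_rootedHypertreeSeries, ?_⟩
  have hsubst : PowerSeries.HasSubst (specializeOne rootedHypertreeSeries) :=
    .of_constantCoeff_zero' constantCoeff_specializeOne_rootedHypertreeSeries
  have hfunctional := subst_specializeOne_rootedHypertreeSeries
  rw [← PowerSeries.coe_substAlgHom hsubst, map_mul, map_sub, map_one,
    PowerSeries.substAlgHom_X, PowerSeries.coe_substAlgHom] at hfunctional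
  linear_combination hfunctional
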